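/- All compact groups are Hausdorff. Let $G$ be a compact group, let $K\le G$ be a closed subgroup, and let $\mu$ and $\nu$ be the normalized Haar measures (the regular left-invariant Borel probability measures) of $G$ and $K$. Put $$Pr(K,G)=(\nu\times\mu)\bigl(\{(x,y)\in K\times G : xy=yx\}\bigr),$$ the probability that a random element of $K$ commutes with a random element of $G$. For subgroups $T,B\le G$, let $[T,B]$ denote the subgroup generated by all commutators $[t,b]$ with $t\in T$, $b\in B$. **Proposition.** For every real $\epsilon>0$ there is a natural number $n=n(\epsilon)$, depending only on $\epsilon$, such that the following holds. Let $G$ be a compact group and let $K$ be a closed subgroup of $G$ with $Pr(K,G)\ge\epsilon$. Then there are a closed normal subgroup $T$ of $G$ and a closed subgroup $B$ of $K$ such that the indices $[G:T]$ and $[K:B]$ and the order of $[T,B]$ are all finite and at most $n$. -/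

import Mathlib

open MeasureTheory
open scoped ENNReal

/-- The normalized Haar measure of a compact group: the regular left-invariant Borel measure
of total mass `1`. -/
noncomputable def normalizedHaar (H : Type*) [Group H] [TopologicalSpace H]
    [IsTopologicalGroup H] [CompactSpace H] [MeasurableSpace H] [BorelSpace H] : Measure H :=
  Measure.haarMeasure ⊤

/-- The probability `Pr(K, G) = (ν × μ) {(x, y) ∈ K × G | x y = y x}` that a random element of the
closed subgroup `K` commutes with a random element of the compact group `G`, where `ν` and `μ` are
the normalized Haar measures of `K` and of `G`. (If `G` is not second countable, this closed set
need not belong to the product of the two Borel `σ`-algebras; its measure is then the outer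
measure, and it is the expected one: see `commutingProbability_eq_lintegral` below.) -/
noncomputable def commutingProbability {G : Type*} [Group G] [TopologicalSpace G]
    [IsTopologicalGroup G] [CompactSpace G] [MeasurableSpace G] [BorelSpace G]
    (K : Subgroup G) (hK : IsClosed (K : Set G)) : ℝ≥0∞ :=
  haveI : CompactSpace K := isCompact_iff_compactSpace.mp hK.isCompact
  ((normalizedHaar K).prod (normalizedHaar G)) {p : K × G | (p.1 : G) * p.2 = p.2 * (p.1 : G)}

instance normalizedHaar_isProbabilityMeasure (H : Type*) [Group H] [TopologicalSpace H]
    [IsTopologicalGroup H] [CompactSpace H] [MeasurableSpace H] [BorelSpace H] :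
    IsProbabilityMeasure (normalizedHaar H) :=
  ⟨Measure.haarMeasure_self (K₀ := (⊤ : TopologicalSpace.PositiveCompacts H))⟩

instance normalizedHaar_regular (H : Type*) [Group H] [TopologicalSpace H]
    [IsTopologicalGroup H] [CompactSpace H] [MeasurableSpace H] [BorelSpace H] :
    (normalizedHaar H).Regular := by
  unfold normalizedHaar; infer_instance

/-- The product measure of a closed set is the integral of the measures of its fibres, also when
the set is not measurable for the product `σ`-algebra. -/
theorem prod_apply_of_isClosed {X Y : Type*} [TopologicalSpace X] [TopologicalSpace Y]
    [T2Space X] [CompactSpace Y]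
    [MeasurableSpace X] [BorelSpace X] [MeasurableSpace Y] [BorelSpace Y]
    (ν : Measure X) (μ : Measure Y) [IsFiniteMeasure ν] [IsFiniteMeasure μ] [ν.Regular]
    [μ.Regular] {C : Set (X × Y)} (hC : IsClosed C) :
    (ν.prod μ) C = ∫⁻ x, μ (Prod.mk x ⁻¹' C) ∂ν := by
  set φ : X → ℝ≥0∞ := fun x => μ (Prod.mk x ⁻¹' C) with hφ
  have key : ∀ (c : ℝ≥0∞) (x : X), φ x < c → ∃ U : Set X, IsOpen U ∧ x ∈ U ∧ ∃ V : Set Y,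
      IsOpen V ∧ μ V < c ∧ ∀ x' ∈ U, Prod.mk x' ⁻¹' C ⊆ V := by
    intro c x hx
    obtain ⟨V, hCV, hV, hVc⟩ := Set.exists_isOpen_lt_of_lt _ c hx
    refine ⟨(Prod.fst '' (C ∩ Prod.snd ⁻¹' Vᶜ))ᶜ, ?_, ?_, V, hV, hVc, ?_⟩
    · exact (isClosedMap_fst_of_compactSpace _
        (hC.inter (hV.isClosed_compl.preimage continuous_snd))).isOpen_compl
    · rintro ⟨⟨a, b⟩, ⟨h1, h2⟩, rfl⟩
      exact h2 (hCV h1)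
    · intro x' hx' y hy
      by_contra hyV
      exact hx' ⟨(x', y), ⟨hy, hyV⟩, rfl⟩
  have hmeas : Measurable φ := by
    refine measurable_of_Iio fun c => IsOpen.measurableSet ?_
    rw [isOpen_iff_forall_mem_open]
    intro x hx
    obtain ⟨U, hU, hxU, V, -, hVc, hUV⟩ := key c x hx
    exact ⟨U, fun x' hx' => (measure_mono (hUV x' hx')).trans_lt hVc, hU, hxU⟩
  have stepB : ∀ (c : ℝ≥0∞) (L : Set X), IsCompact L → (∀ x ∈ L, φ x < c) →
      ∃ S : Set X, L ⊆ S ∧ MeasurableSet S ∧ ∀ D ⊆ S, MeasurableSet D →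
        (ν.prod μ) (C ∩ D ×ˢ Set.univ) ≤ c * ν D := by
    intro c L hL hLc
    refine hL.induction_on (p := fun s => ∃ S : Set X, s ⊆ S ∧ MeasurableSet S ∧ ∀ D ⊆ S,
      MeasurableSet D → (ν.prod μ) (C ∩ D ×ˢ Set.univ) ≤ c * ν D) ?_ ?_ ?_ ?_
    · refine ⟨∅, subset_rfl, MeasurableSet.empty, fun D hD _ => ?_⟩
      rw [Set.subset_empty_iff.mp hD]
      simp
    · rintro s t hst ⟨S, hS, h⟩
      exact ⟨S, hst.trans hS, h⟩
    · rintro s t ⟨S, hsS, hS, h⟩ ⟨S', hsS', hS', h'⟩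
      refine ⟨S ∪ S', Set.union_subset_union hsS hsS', hS.union hS', fun D hD hDm => ?_⟩
      have e : C ∩ D ×ˢ Set.univ = (C ∩ (D ∩ S) ×ˢ Set.univ) ∪ (C ∩ (D \ S) ×ˢ Set.univ) := by
        ext ⟨a, b⟩
        simp only [Set.mem_inter_iff, Set.mem_prod, Set.mem_univ, and_true, Set.mem_union,
          Set.mem_sdiff]
        tauto
      rw [e, ← measure_inter_add_sdiff D hS, mul_add]
      refine (measure_union_le _ _).trans (add_le_add (h _ Set.inter_subset_right (hDm.inter hS))
        (h' _ ?_ (hDm.diff hS)))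
      rintro a ⟨ha, ha'⟩
      exact (hD ha).resolve_left ha'
    · intro x hx
      obtain ⟨U, hU, hxU, V, hV, hVc, hUV⟩ := key c x (hLc x hx)
      refine ⟨U, mem_nhdsWithin_of_mem_nhds (hU.mem_nhds hxU), U, subset_rfl, hU.measurableSet,
        fun D hD hDm => ?_⟩
      calc (ν.prod μ) (C ∩ D ×ˢ Set.univ) ≤ (ν.prod μ) (D ×ˢ V) :=
            measure_mono (fun p hp => ⟨hp.2.1, hUV p.1 (hD hp.2.1) hp.1⟩)
        _ = ν D * μ V := Measure.prod_prod _ _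
        _ ≤ c * ν D := by rw [mul_comm]; gcongr
  have stepC : ∀ (c : ℝ≥0∞) (D : Set X), MeasurableSet D → (∀ x ∈ D, φ x < c) →
      (ν.prod μ) (C ∩ D ×ˢ Set.univ) ≤ c * ν D := by
    intro c D hD hDc
    have bound : ∀ η : ℝ≥0∞, η ≠ 0 →
        (ν.prod μ) (C ∩ D ×ˢ Set.univ) ≤ c * ν D + η * μ Set.univ := by
      intro η hη
      obtain ⟨L, hLD, hL, hLη⟩ := hD.exists_isCompact_sdiff_lt (measure_ne_top ν D) hη
      obtain ⟨S, hLS, -, hS⟩ := stepB c L hL (fun x hx => hDc x (hLD hx))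
      have e : C ∩ D ×ˢ Set.univ ⊆ (C ∩ L ×ˢ Set.univ) ∪ ((D \ L) ×ˢ Set.univ) := by
        rintro ⟨a, b⟩ ⟨h1, h2, -⟩
        by_cases ha : a ∈ L
        · exact Or.inl ⟨h1, ha, trivial⟩
        · exact Or.inr ⟨⟨h2, ha⟩, trivial⟩
      refine (measure_mono e).trans ((measure_union_le _ _).trans (add_le_add ?_ ?_))
      · exact (hS L hLS hL.measurableSet).trans (by gcongr)
      · rw [Measure.prod_prod]
        gcongr
    refine ENNReal.le_of_forall_pos_le_add fun ε hε _ => ?_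
    have hM : μ Set.univ + 1 ≠ ⊤ := by simp
    refine (bound (ε / (μ Set.univ + 1)) ?_).trans ?_
    · exact (ENNReal.div_pos (by simpa using hε.ne') hM).ne'
    · gcongr
      calc (ε : ℝ≥0∞) / (μ Set.univ + 1) * μ Set.univ
          ≤ (ε : ℝ≥0∞) / (μ Set.univ + 1) * (μ Set.univ + 1) := by
            gcongr
            exact le_self_add
        _ = ε := ENNReal.div_mul_cancel (by simp) hM
  set A := toMeasurable (ν.prod μ) C with hA
  have hAm : MeasurableSet A := measurableSet_toMeasurable _ _
  have hψ : Measurable fun x => μ (Prod.mk x ⁻¹' A) := measurable_measure_prodMk_left hAm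
  have hle : ∀ x, φ x ≤ μ (Prod.mk x ⁻¹' A) := fun x =>
    measure_mono (Set.preimage_mono (subset_toMeasurable _ _))
  have hDint : ∀ D, MeasurableSet D →
      ∫⁻ x in D, μ (Prod.mk x ⁻¹' A) ∂ν = (ν.prod μ) (C ∩ D ×ˢ Set.univ) := by
    intro D hD
    rw [← Measure.measure_toMeasurable_inter (hD.prod MeasurableSet.univ) (measure_ne_top _ C),
      Measure.prod_apply (hAm.inter (hD.prod MeasurableSet.univ)), ← lintegral_indicator hD]
    refine lintegral_congr fun x => ?_
    by_cases hx : x ∈ D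
    · rw [Set.indicator_of_mem hx]
      congr 1
      ext y
      simp [hx, hA]
    · rw [Set.indicator_of_notMem hx]
      symm
      convert measure_empty (μ := μ)
      ext y
      simp [hx]
  have hae : ∀ᵐ x ∂ν, μ (Prod.mk x ⁻¹' A) ≤ φ x := by
    obtain ⟨s, hs, hsd⟩ := TopologicalSpace.exists_countable_dense ℝ≥0∞
    have h0 : ∀ q ∈ s, ∀ᵐ x ∂ν, ¬ (φ x < q ∧ q < μ (Prod.mk x ⁻¹' A)) := by
      intro q _
      set D : Set X := {x | φ x < q ∧ q < μ (Prod.mk x ⁻¹' A)} with hDdef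
      have hD : MeasurableSet D :=
        (measurableSet_lt hmeas measurable_const).inter (measurableSet_lt measurable_const hψ)
      have h1 := stepC q D hD (fun x hx => hx.1)
      rw [← hDint D hD] at h1
      have : ν D = 0 := by
        by_contra hne
        have hq : q ≠ ⊤ := by
          obtain ⟨x, hx⟩ := nonempty_of_measure_ne_zero hne
          exact (hx.2.trans_le le_top).ne
        have h2 : ∫⁻ x in D, q ∂ν < ∫⁻ x in D, μ (Prod.mk x ⁻¹' A) ∂ν := by
          refine setLIntegral_strict_mono hD hne hψ ?_ ?_
          · rw [setLIntegral_const]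
            exact ENNReal.mul_ne_top hq (measure_ne_top _ _)
          · exact Filter.Eventually.of_forall fun x hx => hx.2
        rw [setLIntegral_const] at h2
        exact absurd h1 (not_le.mpr h2)
      rw [ae_iff]
      simpa only [not_not] using this
    filter_upwards [(ae_ball_iff hs).mpr h0] with x hx
    by_contra! hlt
    obtain ⟨q, hq, h1, h2⟩ := hsd.exists_between hlt
    exact hx q hq ⟨h1, h2⟩
  rw [← measure_toMeasurable C, Measure.prod_apply hAm]
  refine lintegral_congr_ae ?_
  filter_upwards [hae] with x hx
  exact le_antisymm hx (hle x)

/-- `Pr(K, G) = ∫_K μ(C_G(x)) dν(x)`. -/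
theorem commutingProbability_eq_lintegral {G : Type*} [Group G] [TopologicalSpace G]
    [IsTopologicalGroup G] [CompactSpace G] [T2Space G] [MeasurableSpace G] [BorelSpace G]
    (K : Subgroup G) (hK : IsClosed (K : Set G)) :
    haveI : CompactSpace K := isCompact_iff_compactSpace.mp hK.isCompact
    commutingProbability K hK =
      ∫⁻ x : K, normalizedHaar G {y : G | (x : G) * y = y * (x : G)} ∂(normalizedHaar K) := by
  have : CompactSpace K := isCompact_iff_compactSpace.mp hK.isCompact
  exact prod_apply_of_isClosed _ _ (isClosed_eq (by fun_prop) (by fun_prop))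

/-! Fubini turns `Pr(K, G)` into the mean of `μ(C_G(x))` over `K` and into the mean of `ν(C_K(y))`
over `G`. So a set of measure at least `ε/2` in each group consists of elements whose centralizer in
the other group has index at most `N`, where `N > 2/ε`. The elements with centralizer of index at
most `n` form symmetric sets `S n` with `S m * S n ⊆ S (m * n)`. Disjoint translates cannot exceed
total mass 1, and this forces some `S n` of bounded level to be a subgroup of bounded index
(`exists_subgroup_eq_of_filtration`).

This gives `B ≤ K` and `E ≤ G` in which each element has at most `M` conjugates under the other
group. What remains is algebra in the style of B. H. Neumann. Comparison with an element of `B`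
having the most conjugates under `E` confines the commutators with a large subgroup of `B` to a
bounded set. Further subgroups of bounded index centralize these commutators, which then commute,
have bounded order and generate a bounded group. Normal core and closure finish the proof. -/

/-! ### Bounded relative index. -/

section RelIndexLE

variable {G : Type*} [Group G]

/-- The relative index of `A` in `L` is finite and at most `n`. -/
def RelIndexLE (A L : Subgroup G) (n : ℕ) : Prop :=
  A.relIndex L ≠ 0 ∧ A.relIndex L ≤ n

theorem RelIndexLE.mono {A A' L : Subgroup G} {n n' : ℕ} (h : RelIndexLE A L n) (hA : A ≤ A')
    (hn : n ≤ n') : RelIndexLE A' L n' :=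
  ⟨fun h0 => h.1 (Subgroup.relIndex_eq_zero_of_le_left hA h0),
    (Subgroup.relIndex_le_of_le_left hA h.1).trans (h.2.trans hn)⟩

theorem RelIndexLE.mono_right {A L L' : Subgroup G} {n : ℕ} (h : RelIndexLE A L n) (hL : L' ≤ L) :
    RelIndexLE A L' n :=
  ⟨fun h0 => h.1 (Subgroup.relIndex_eq_zero_of_le_right hL h0),
    (Subgroup.relIndex_le_of_le_right hL h.1).trans h.2⟩

theorem RelIndexLE.inf {A A' L : Subgroup G} {n n' : ℕ} (h : RelIndexLE A L n)
    (h' : RelIndexLE A' L n') : RelIndexLE (A ⊓ A') L (n * n') :=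
  ⟨Subgroup.relIndex_inf_ne_zero h.1 h'.1,
    Subgroup.relIndex_inf_le.trans (Nat.mul_le_mul h.2 h'.2)⟩

theorem RelIndexLE.iInf {ι : Type*} [Finite ι] {A : ι → Subgroup G} {L : Subgroup G} {n : ℕ}
    (h : ∀ i, RelIndexLE (A i) L n) : RelIndexLE (⨅ i, A i) L (n ^ Nat.card ι) := by
  have := Fintype.ofFinite ι
  refine ⟨Subgroup.relIndex_iInf_ne_zero fun i => (h i).1, (Subgroup.relIndex_iInf_le _).trans ?_⟩
  rw [Nat.card_eq_fintype_card]
  exact Finset.prod_le_pow_card _ _ _ fun i _ => (h i).2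

theorem RelIndexLE.trans {A B L : Subgroup G} {n m : ℕ} (h : RelIndexLE A B n)
    (h' : RelIndexLE B L m) (hAB : A ≤ B) (hBL : B ≤ L) : RelIndexLE A L (n * m) := by
  refine ⟨Subgroup.relIndex_ne_zero_trans h.1 h'.1, ?_⟩
  rw [← Subgroup.relIndex_mul_relIndex A B L hAB hBL]
  exact Nat.mul_le_mul h.2 h'.2

theorem RelIndexLE.inf_left {A L : Subgroup G} {n : ℕ} (h : RelIndexLE A L n) :
    RelIndexLE (L ⊓ A) L n := by
  rw [RelIndexLE, inf_comm, Subgroup.inf_relIndex_right]; exact h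

/-- The core is the kernel of the action on the cosets of `A`, so its index divides the order of a
symmetric group. -/
theorem RelIndexLE.normalCore {A : Subgroup G} {n : ℕ} (h : RelIndexLE A ⊤ n) :
    RelIndexLE A.normalCore ⊤ n.factorial := by
  simp only [RelIndexLE, Subgroup.relIndex_top_right] at *
  have hd : A.normalCore.index ∣ A.index.factorial := by
    have : Finite (G ⧸ A) := Subgroup.index_ne_zero_iff_finite.mp h.1
    rw [Subgroup.normalCore_eq_ker, Subgroup.index_ker, Subgroup.index_eq_card, ← Nat.card_perm]
    exact Subgroup.card_subgroup_dvd_card _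
  exact ⟨fun h0 => A.index.factorial_ne_zero (Nat.eq_zero_of_zero_dvd (h0 ▸ hd)),
    (Nat.le_of_dvd (Nat.factorial_pos _) hd).trans (Nat.factorial_le h.2)⟩

/-- A subgroup has index at most `n` iff among any `n + 1` elements two lie in the same coset. -/
theorem relIndexLE_iff_forall_fin {A L : Subgroup G} {n : ℕ} :
    RelIndexLE A L n ↔
      ∀ g : Fin (n + 1) → L, ∃ i j, i ≠ j ∧ ((g i)⁻¹ * g j : G) ∈ A := by
  have key : ∀ x y : L, (x : L ⧸ A.subgroupOf L) = y ↔ ((x : G)⁻¹ * y) ∈ A := fun x y => by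
    rw [QuotientGroup.eq, Subgroup.mem_subgroupOf]; simp
  rw [RelIndexLE, Subgroup.relIndex, Subgroup.index_ne_zero_iff_finite, Subgroup.index_eq_card]
  constructor
  · rintro ⟨hf, hn⟩ g
    have := Fintype.ofFinite (L ⧸ A.subgroupOf L)
    obtain ⟨i, j, hij, h⟩ := Fintype.exists_ne_map_eq_of_card_lt
      (fun i => (g i : L ⧸ A.subgroupOf L)) (by
        rw [Fintype.card_fin, ← Nat.card_eq_fintype_card]; omega)
    exact ⟨i, j, hij, (key _ _).mp h⟩
  · intro h
    have no_emb : ¬ Nonempty (Fin (n + 1) ↪ L ⧸ A.subgroupOf L) := by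
      rintro ⟨f⟩
      obtain ⟨i, j, hij, hA⟩ := h fun i => (f i).out
      refine hij (f.injective ?_)
      rw [← QuotientGroup.out_eq' (f i), ← QuotientGroup.out_eq' (f j)]
      exact (key _ _).mpr hA
    have hf : Finite (L ⧸ A.subgroupOf L) := by
      by_contra hinf
      rw [not_finite_iff_infinite] at hinf
      exact no_emb ⟨Fin.valEmbedding.trans (Infinite.natEmbedding _)⟩
    refine ⟨hf, ?_⟩
    by_contra! hlt
    have := Fintype.ofFinite (L ⧸ A.subgroupOf L)
    refine no_emb (Function.Embedding.nonempty_of_card_le ?_)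
    rwa [Fintype.card_fin, ← Nat.card_eq_fintype_card]

end RelIndexLE

/-! ### Orbit–stabilizer for conjugation. -/

section Conjugates

variable {G : Type*} [Group G]

/-- The set of conjugates of `a` by elements of `L`. -/
def conjugatesBy (L : Subgroup G) (a : G) : Set G := Set.range fun g : L => (g : G) * a * (g : G)⁻¹

theorem card_conjugatesBy (L : Subgroup G) (a : G) :
    Nat.card (conjugatesBy L a) = (Subgroup.centralizer {a}).relIndex L := by
  rw [Subgroup.relIndex, Subgroup.index_eq_card]
  have hker : Setoid.ker (fun g : L => (g : G) * a * (g : G)⁻¹) =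
      QuotientGroup.leftRel ((Subgroup.centralizer {a}).subgroupOf L) := by
    ext g h
    rw [Setoid.ker_def, QuotientGroup.leftRel_apply, Subgroup.mem_subgroupOf,
      Subgroup.mem_centralizer_singleton_iff]
    simp only [Subgroup.coe_mul, Subgroup.coe_inv]
    constructor
    · intro e
      have : a = (g : G)⁻¹ * (h * a * (h : G)⁻¹) * g := by rw [← e]; group
      nth_rw 2 [this]; group
    · intro e
      have : (g : G)⁻¹ * h * a * ((g : G)⁻¹ * h)⁻¹ = a := by
        rw [mul_inv_eq_iff_eq_mul, e]
      nth_rw 1 [← this]; group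
  refine Nat.card_congr ((Setoid.quotientKerEquivRange _).symm.trans ?_)
  exact Quotient.congrRight fun x y => by rw [hker]

theorem RelIndexLE.finite_conjugatesBy {L : Subgroup G} {a : G} {n : ℕ}
    (h : RelIndexLE (Subgroup.centralizer {a}) L n) :
    (conjugatesBy L a).Finite ∧ (conjugatesBy L a).ncard ≤ n := by
  rw [RelIndexLE, ← card_conjugatesBy] at h
  exact ⟨Nat.finite_of_card_ne_zero h.1, h.2⟩

theorem relIndexLE_centralizer_of_conj_mem {L : Subgroup G} {a : G} {F : Set G} (hF : F.Finite)
    (h : ∀ g ∈ L, g * a * g⁻¹ ∈ F) : RelIndexLE (Subgroup.centralizer {a}) L F.ncard := by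
  have hsub : conjugatesBy L a ⊆ F := by rintro _ ⟨g, rfl⟩; exact h g g.2
  have : Finite (conjugatesBy L a) := hF.subset hsub
  have : Nonempty (conjugatesBy L a) := ⟨⟨_, 1, rfl⟩⟩
  rw [RelIndexLE, ← card_conjugatesBy]
  exact ⟨Nat.card_pos.ne', Set.ncard_le_ncard hsub hF⟩

end Conjugates

/-! ### From bounded conjugacy classes to a finite commutator subgroup. -/

section Commutators

open scoped commutatorElement

variable {G : Type*} [Group G]

/-- If every element of `B` has at most `M` conjugates under `E` and vice versa, then the
commutators of `E` with a subgroup of bounded index of `B` form a bounded finite set. -/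
theorem exists_le_commutatorElement_mem_finite {B E : Subgroup G} {M : ℕ}
    (hB : ∀ b ∈ B, RelIndexLE (Subgroup.centralizer {b}) E M)
    (hE : ∀ e ∈ E, RelIndexLE (Subgroup.centralizer {e}) B M) :
    ∃ U ≤ B, RelIndexLE U B (M ^ M) ∧ ∃ D : Set G, D.Finite ∧ D.ncard ≤ M * M ∧
      ∀ g ∈ E, ∀ u ∈ U, ⁅g, u⁆ ∈ D := by
  have hM : 0 < M := (Nat.pos_of_ne_zero (hB 1 B.one_mem).1).trans_le (hB 1 B.one_mem).2
  -- Take `a` with the most conjugates under `E`: any `a * u` that has at least these many, in a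
  -- known form, has no others.
  obtain ⟨a, ha, hmax⟩ : ∃ a ∈ B, ∀ b ∈ B,
      (conjugatesBy E b).ncard ≤ (conjugatesBy E a).ncard := by
    have hfin : ((fun b => (conjugatesBy E b).ncard) '' (B : Set G)).Finite :=
      (Set.finite_Iic M).subset (by
        rintro _ ⟨b, hb, rfl⟩
        exact (hB b hb).finite_conjugatesBy.2)
    obtain ⟨_, ⟨a, ha, rfl⟩, h⟩ := Set.exists_max_image _ id hfin ⟨_, 1, B.one_mem, rfl⟩
    exact ⟨a, ha, fun b hb => h _ ⟨b, hb, rfl⟩⟩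
  obtain ⟨hOf, hOM⟩ := (hB a ha).finite_conjugatesBy
  set O := conjugatesBy E a with hO
  have hfO : Finite O := hOf
  choose r hr using fun α : O => α.2
  -- Each `r α` conjugates `a` to `α`. Elements `u` of `C` commute with every `r α`, so `r α`
  -- conjugates `a * u` to `α * u`.
  set C : Subgroup G := ⨅ α : O, Subgroup.centralizer {(r α : G)} with hC
  have hCU : RelIndexLE C B (M ^ M) :=
    (RelIndexLE.iInf fun α => hE _ (r α).2).mono le_rfl (Nat.pow_le_pow_right hM hOM)
  refine ⟨B ⊓ C, inf_le_left, hCU.inf_left, (fun p : G × G => p.1⁻¹ * p.2) '' (O ×ˢ O),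
    (hOf.prod hOf).image _, ?_, ?_⟩
  · refine (Set.ncard_image_le (hOf.prod hOf)).trans ?_
    rw [Set.ncard_prod]
    exact Nat.mul_le_mul hOM hOM
  · rintro g hg u ⟨huB, huC⟩
    have hau := B.mul_mem ha huB
    have hcomm : ∀ α : O, (r α : G) * u = u * r α := fun α =>
      (Subgroup.mem_centralizer_singleton_iff.mp ((Subgroup.mem_iInf.mp huC) α)).symm
    have hsub : (· * u) '' O ⊆ conjugatesBy E (a * u) := by
      rintro _ ⟨α, hα, rfl⟩
      refine ⟨r ⟨α, hα⟩, ?_⟩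
      have h1 : (r ⟨α, hα⟩ : G) * a * (r ⟨α, hα⟩ : G)⁻¹ = α := hr ⟨α, hα⟩
      have h2 := hcomm ⟨α, hα⟩
      change (r ⟨α, hα⟩ : G) * (a * u) * (r ⟨α, hα⟩ : G)⁻¹ = α * u
      generalize (r ⟨α, hα⟩ : G) = b at h1 h2 ⊢
      rw [← h1]
      have h3 : u * b⁻¹ = b⁻¹ * u := by
        rw [eq_inv_mul_iff_mul_eq, ← mul_assoc, h2, mul_inv_cancel_right]
      simp only [mul_assoc, h3]
    have heq : (· * u) '' O = conjugatesBy E (a * u) := by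
      refine Set.eq_of_subset_of_ncard_le hsub ?_ (hB _ hau).finite_conjugatesBy.1
      rw [Set.ncard_image_of_injective _ (mul_left_injective u)]
      exact hmax _ hau
    have hmem : g * (a * u) * g⁻¹ ∈ (· * u) '' O := by rw [heq]; exact ⟨⟨g, hg⟩, rfl⟩
    obtain ⟨β, hβ, e⟩ := hmem
    -- From `g(au)g⁻¹ = βu` follows `⁅g, u⁆ = (gag⁻¹)⁻¹β`, a quotient of two conjugates of `a`.
    refine ⟨(g * a * g⁻¹, β), ⟨⟨⟨g, hg⟩, rfl⟩, hβ⟩, ?_⟩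
    have : β = g * (a * u) * g⁻¹ * u⁻¹ := by rw [← e]; simp
    simp only [this, commutatorElement_def]
    group

/-- If the commutators of `E` and `U` lie in a set of size `m`, then subgroups of bounded index
centralize all of these commutators. -/
theorem exists_le_centralizing_commutators {E U : Subgroup G} {D : Set G} (hD : D.Finite) {m : ℕ}
    (hm : D.ncard ≤ m) (h : ∀ g ∈ E, ∀ u ∈ U, ⁅g, u⁆ ∈ D) :
    ∃ E₀ ≤ E, ∃ U₀ ≤ U, RelIndexLE E₀ E ((m * m) ^ m) ∧ RelIndexLE U₀ U ((m * m) ^ m) ∧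
      ∀ g ∈ E, ∀ u ∈ U, (∀ x ∈ E₀, Commute x ⁅g, u⁆) ∧ ∀ x ∈ U₀, Commute x ⁅g, u⁆ := by
  set S : Set G := {s | ∃ g ∈ E, ∃ u ∈ U, ⁅g, u⁆ = s} with hS
  have hSD : S ⊆ D := by rintro _ ⟨g, hg, u, hu, rfl⟩; exact h g hg u hu
  have hSf : Finite S := hD.subset hSD
  have hSm : Nat.card S ≤ m := (Set.ncard_le_ncard hSD hD).trans hm
  have hm0 : 0 < m := by
    refine Nat.lt_of_lt_of_le ((Set.ncard_pos hD).mpr ⟨_, h 1 E.one_mem 1 U.one_mem⟩) hm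
  have hF (f : G × G → G) : (f '' (D ×ˢ D)).Finite ∧ (f '' (D ×ˢ D)).ncard ≤ m * m := by
    refine ⟨(hD.prod hD).image _, (Set.ncard_image_le (hD.prod hD)).trans ?_⟩
    rw [Set.ncard_prod]
    exact Nat.mul_le_mul hm hm
  set C : Subgroup G := ⨅ s : S, Subgroup.centralizer {(s : G)} with hC
  have hcomm : ∀ x ∈ C, ∀ s ∈ S, Commute x s := fun x hx s hs =>
    Subgroup.mem_centralizer_singleton_iff.mp (Subgroup.mem_iInf.mp hx ⟨s, hs⟩)
  have hle : (m * m) ^ Nat.card S ≤ (m * m) ^ m :=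
    Nat.pow_le_pow_right (Nat.mul_pos hm0 hm0) hSm
  have hEC : RelIndexLE C E ((m * m) ^ m) := by
    refine (RelIndexLE.iInf fun s => ?_).mono le_rfl hle
    obtain ⟨_, g, hg, u, hu, rfl⟩ := s
    obtain ⟨h1, h2⟩ := hF fun p => p.1 * p.2⁻¹
    refine (relIndexLE_centralizer_of_conj_mem h1 fun x hx => ?_).mono le_rfl h2
    -- `x⁅g, u⁆x⁻¹ = ⁅xg, u⁆⁅x, u⁆⁻¹`, so at most `m * m` conjugates arise.
    refine ⟨(⁅x * g, u⁆, ⁅x, u⁆), ⟨h _ (E.mul_mem hx hg) _ hu, h _ hx _ hu⟩, ?_⟩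
    simp only [commutatorElement_def]; group
  have hUC : RelIndexLE C U ((m * m) ^ m) := by
    refine (RelIndexLE.iInf fun s => ?_).mono le_rfl hle
    obtain ⟨_, g, hg, u, hu, rfl⟩ := s
    obtain ⟨h1, h2⟩ := hF fun p => p.1⁻¹ * p.2
    refine (relIndexLE_centralizer_of_conj_mem h1 fun x hx => ?_).mono le_rfl h2
    -- Symmetrically, `x⁅g, u⁆x⁻¹ = ⁅g, x⁆⁻¹⁅g, xu⁆`.
    refine ⟨(⁅g, x⁆, ⁅g, x * u⁆), ⟨h _ hg _ hx, h _ hg _ (U.mul_mem hx hu)⟩, ?_⟩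
    simp only [commutatorElement_def]; group
  exact ⟨E ⊓ C, inf_le_left, U ⊓ C, inf_le_left, hEC.inf_left, hUC.inf_left, fun g hg u hu =>
    ⟨fun x hx => hcomm x hx.2 _ ⟨g, hg, u, hu, rfl⟩, fun x hx => hcomm x hx.2 _ ⟨g, hg, u, hu, rfl⟩⟩⟩

open scoped IsMulCommutative in
/-- A set of at most `m` pairwise commuting elements, each with all its powers in a set of size
at most `m`, generates a finite group of bounded order. -/
theorem finite_closure_of_pairwise_commute {S : Set G} (hS : S.Finite) {m : ℕ} (hm : S.ncard ≤ m)
    (hcomm : ∀ x ∈ S, ∀ y ∈ S, x * y = y * x) (hpow : ∀ x ∈ S, ∀ k : ℕ, x ^ k ∈ S) :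
    Finite (Subgroup.closure S) ∧ Nat.card (Subgroup.closure S) ≤ m.factorial ^ m := by
  have hSf : Finite S := hS
  have hcg := Subgroup.isMulCommutative_closure hcomm
  have hexp : ∀ x ∈ S, x ^ m.factorial = 1 := by
    intro x hx
    have hsub : (Submonoid.powers x : Set G) ⊆ S := by
      rintro _ ⟨k, rfl⟩; exact hpow x hx k
    have hfin : (Submonoid.powers x : Set G).Finite := hS.subset hsub
    have hx0 : IsOfFinOrder x := finite_powers.mp hfin
    have hle : orderOf x ≤ m := by
      rw [← Nat.card_submonoidPowers]
      exact (Set.ncard_le_ncard hsub hS).trans hm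
    exact orderOf_dvd_iff_pow_eq_one.mp (Nat.dvd_factorial hx0.orderOf_pos hle)
  have hexp' : ∀ g : Subgroup.closure S, g ^ m.factorial = 1 := by
    rintro ⟨g, hg⟩
    induction hg using Subgroup.closure_induction with
    | mem x hx => exact Subtype.ext (hexp x hx)
    | one => exact one_pow _
    | mul x y hx hy ihx ihy =>
      have e : (⟨x * y, mul_mem hx hy⟩ : Subgroup.closure S) = ⟨x, hx⟩ * ⟨y, hy⟩ := rfl
      rw [e, mul_pow, ihx, ihy, one_mul]
    | inv x hx ihx =>
      have e : (⟨x⁻¹, inv_mem hx⟩ : Subgroup.closure S) = ⟨x, hx⟩⁻¹ := rfl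
      rw [e, inv_pow, ihx, inv_one]
  have hrank := Subgroup.rank_closure_finite_le_nat_card S
  -- An abelian group with at most `m` generators and exponent dividing `m!` has order dividing `m!
  -- ^ m`.
  have hdvd := card_dvd_exponent_pow_rank' (Subgroup.closure S) hexp'
  have hdvd' := hdvd.trans (pow_dvd_pow m.factorial (hrank.trans hm))
  have hne : m.factorial ^ m ≠ 0 := pow_ne_zero _ m.factorial_ne_zero
  exact ⟨Nat.finite_of_card_ne_zero fun h0 => hne (Nat.eq_zero_of_zero_dvd (h0 ▸ hdvd')),
    Nat.le_of_dvd (Nat.pos_of_ne_zero hne) hdvd'⟩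

/-- Since `g` and `u` centralize all the commutators, these commute with one another. Moreover `⁅g ^
k, u⁆ = ⁅g, u⁆ ^ k`, so powers of commutators stay in the bounded set `D`. -/
theorem finite_commutator_of_commute_commutatorElement {E U : Subgroup G} {D : Set G}
    (hD : D.Finite) {m : ℕ} (hm : D.ncard ≤ m) (h : ∀ g ∈ E, ∀ u ∈ U, ⁅g, u⁆ ∈ D)
    (hE : ∀ x ∈ E, ∀ g ∈ E, ∀ u ∈ U, Commute x ⁅g, u⁆)
    (hU : ∀ x ∈ U, ∀ g ∈ E, ∀ u ∈ U, Commute x ⁅g, u⁆) :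
    Finite ↥⁅E, U⁆ ∧ Nat.card ↥⁅E, U⁆ ≤ m.factorial ^ m := by
  rw [Subgroup.commutator_def]
  set S : Set G := {s | ∃ g ∈ E, ∃ u ∈ U, ⁅g, u⁆ = s} with hS
  have hSD : S ⊆ D := by rintro _ ⟨g, hg, u, hu, rfl⟩; exact h g hg u hu
  refine finite_closure_of_pairwise_commute (hD.subset hSD) ((Set.ncard_le_ncard hSD hD).trans hm)
    ?_ ?_
  · rintro _ ⟨g, hg, u, hu, rfl⟩ _ ⟨g', hg', u', hu', rfl⟩
    have h1 := hE g hg g' hg' u' hu'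
    have h2 := hU u hu g' hg' u' hu'
    rw [commutatorElement_def g u]
    exact (((h1.mul_left h2).mul_left h1.inv_left).mul_left h2.inv_left).eq
  · rintro _ ⟨g, hg, u, hu, rfl⟩ k
    refine ⟨g ^ k, pow_mem hg k, u, hu, ?_⟩
    induction k with
    | zero => simp
    | succ k ih =>
      have h1 := hE g hg (g ^ k) (pow_mem hg k) u hu
      have e : ⁅g ^ (k + 1), u⁆ = (g * ⁅g ^ k, u⁆ * g⁻¹) * ⁅g, u⁆ := by
        simp only [commutatorElement_def, pow_succ']; group
      rw [e, h1.eq, mul_inv_cancel_right, ih, pow_succ]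

/-- If every element of `B` has at most `M` conjugates under `E` and vice versa, then some subgroups
of bounded index of `E` and `B` have a finite commutator subgroup of bounded order. -/
theorem exists_finite_commutator {B E : Subgroup G} {M : ℕ}
    (hB : ∀ b ∈ B, RelIndexLE (Subgroup.centralizer {b}) E M)
    (hE : ∀ e ∈ E, RelIndexLE (Subgroup.centralizer {e}) B M) :
    ∃ E₀ ≤ E, ∃ U₀ ≤ B, RelIndexLE E₀ E ((M * M * (M * M)) ^ (M * M)) ∧
      RelIndexLE U₀ B ((M * M * (M * M)) ^ (M * M) * M ^ M) ∧
      Finite ↥⁅E₀, U₀⁆ ∧ Nat.card ↥⁅E₀, U₀⁆ ≤ (M * M).factorial ^ (M * M) := by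
  obtain ⟨U, hUB, hU, D, hD, hDM, hmem⟩ := exists_le_commutatorElement_mem_finite hB hE
  obtain ⟨E₀, hE₀, U₀, hU₀, hEi, hUi, hc⟩ := exists_le_centralizing_commutators hD hDM hmem
  exact ⟨E₀, hE₀, U₀, hU₀.trans hUB, hEi, hUi.trans hU hU₀ hUB,
    finite_commutator_of_commute_commutatorElement hD hDM
      (fun g hg u hu => hmem g (hE₀ hg) u (hU₀ hu))
      (fun x hx g hg u hu => (hc g (hE₀ hg) u (hU₀ hu)).1 x hx)
      (fun x hx g hg u hu => (hc g (hE₀ hg) u (hU₀ hu)).2 x hx)⟩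

end Commutators

/-! ### Packing translates of sets of positive measure. -/

section Translates

open scoped Pointwise

variable {Γ : Type*} [Group Γ] [MeasurableSpace Γ] [MeasurableMul Γ]
  (μ : Measure Γ) [μ.IsMulLeftInvariant] [IsProbabilityMeasure μ]

/-- More than `1 / μ A` left translates of `A` cannot be pairwise disjoint. -/
theorem exists_mul_eq_mul_of_one_lt_mul_measure {A : Set Γ} (hA : MeasurableSet A) {n : ℕ}
    (h : 1 < n * μ A) (g : Fin n → Γ) :
    ∃ i j, i < j ∧ ∃ a ∈ A, ∃ b ∈ A, g i * a = g j * b := by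
  by_contra! hne
  have hdisj : Pairwise (Function.onFun Disjoint fun i => g i • A) := by
    have : ∀ i j, i < j → Disjoint (g i • A) (g j • A) := by
      intro i j hij
      rw [Set.disjoint_left]
      rintro _ ⟨a, ha, rfl⟩ ⟨b, hb, e⟩
      exact hne i j hij a ha b hb e.symm
    intro i j hij
    rcases lt_or_gt_of_ne hij with h | h
    · exact this i j h
    · exact (this j i h).symm
  have hU := measure_iUnion (μ := μ) hdisj fun i => hA.const_smul (g i)
  simp only [measure_smul, tsum_fintype, Finset.sum_const, Finset.card_univ, Fintype.card_fin,
    nsmul_eq_mul] at hU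
  exact absurd (prob_le_one (μ := μ) (s := ⋃ i, g i • A)) (by rw [hU]; exact not_le.mpr h)

/-- When `g i • A` and `g j • A` meet, `(g i)⁻¹ * g j` lies in `A * A⁻¹ ⊆ H`. -/
theorem relIndexLE_top_of_one_lt_mul_measure {H : Subgroup Γ} {A : Set Γ} (hA : MeasurableSet A)
    (hAH : A ⊆ H) {n : ℕ} (h : 1 < ((n + 1 : ℕ) : ℝ≥0∞) * μ A) : RelIndexLE H ⊤ n := by
  refine relIndexLE_iff_forall_fin.mpr fun g => ?_
  obtain ⟨i, j, hij, a, ha, b, hb, e⟩ :=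
    exists_mul_eq_mul_of_one_lt_mul_measure μ hA h fun i => (g i : Γ)
  refine ⟨i, j, hij.ne, ?_⟩
  have : ((g i)⁻¹ * g j : Γ) = a * b⁻¹ := by
    rw [InvMemClass.coe_inv, inv_mul_eq_iff_eq_mul, ← mul_assoc, e, mul_inv_cancel_right]
  rw [this]
  exact H.mul_mem (hAH ha) (H.inv_mem (hAH hb))

/-- In a filtration by symmetric sets with `S m * S n ⊆ S (m * n)`, some set of bounded index is a
subgroup of bounded index once the sets have positive measure. -/
theorem exists_subgroup_eq_of_filtration {S : ℕ → Set Γ} (hmono : Monotone S)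
    (hone : ∀ n, 0 < n → 1 ∈ S n) (hinv : ∀ n, ∀ x ∈ S n, x⁻¹ ∈ S n)
    (hmul : ∀ m n, ∀ x ∈ S m, ∀ y ∈ S n, x * y ∈ S (m * n)) {N : ℕ} (hN : 0 < N)
    (hS : MeasurableSet (S N)) (h : 1 < ((N + 1 : ℕ) : ℝ≥0∞) * μ (S N)) :
    ∃ H : Subgroup Γ, (H : Set Γ) ⊆ S (N ^ 4 ^ N) ∧ RelIndexLE H ⊤ N := by
  -- Otherwise each level `N ^ 4 ^ j` has a product `x j` outside it. Two translates `x i * S N` and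
  -- `x j * S N` with `i < j` meet, so `x j = x i * a * b⁻¹`. Four factors, each of level at most `N
  -- ^ 4 ^ i`, put `x j` at level `N ^ 4 ^ (i + 1)`, hence at level `N ^ 4 ^ j`: a contradiction.
  -- This is where the base 4 comes from.
  obtain ⟨j, hj⟩ : ∃ j : Fin (N + 1),
      S (N ^ 4 ^ (j : ℕ) * N ^ 4 ^ (j : ℕ)) ⊆ S (N ^ 4 ^ (j : ℕ)) := by
    by_contra! hne
    simp only [Set.not_subset] at hne
    choose x hx hx' using hne
    obtain ⟨i, j, hij, a, ha, b, hb, e⟩ := exists_mul_eq_mul_of_one_lt_mul_measure μ hS h x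
    refine hx' j ?_
    have : x j = x i * a * b⁻¹ := by rw [e, mul_inv_cancel_right]
    rw [this]
    refine hmono ?_ (hmul _ _ _ (hmul _ _ _ (hx i) _ ha) _ (hinv _ _ hb))
    have h1 : N ≤ N ^ 4 ^ (i : ℕ) := Nat.le_self_pow (by positivity) N
    calc N ^ 4 ^ (i : ℕ) * N ^ 4 ^ (i : ℕ) * N * N
        ≤ N ^ 4 ^ (i : ℕ) * N ^ 4 ^ (i : ℕ) * N ^ 4 ^ (i : ℕ) * N ^ 4 ^ (i : ℕ) := by gcongr
      _ = N ^ 4 ^ ((i : ℕ) + 1) := by rw [pow_succ 4, pow_mul]; ring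
      _ ≤ N ^ 4 ^ (j : ℕ) := Nat.pow_le_pow_right hN (Nat.pow_le_pow_right (by norm_num) hij)
  have hNj : N ≤ N ^ 4 ^ (j : ℕ) := Nat.le_self_pow (by positivity) N
  let H : Subgroup Γ :=
    { carrier := S (N ^ 4 ^ (j : ℕ))
      one_mem' := hone _ (by positivity)
      mul_mem' := fun hx hy => hj (hmul _ _ _ hx _ hy)
      inv_mem' := fun hx => hinv _ _ hx }
  exact ⟨H, hmono (Nat.pow_le_pow_right hN
    (Nat.pow_le_pow_right (by norm_num) (Nat.lt_succ_iff.mp j.2))),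
    relIndexLE_top_of_one_lt_mul_measure μ hS (hmono hNj) h⟩

/-- Integrate `φ ≤ 1_S + δ` and cancel one `δ`. -/
theorem le_measure_of_two_mul_le_lintegral {X : Type*} [MeasurableSpace X] {ν : Measure X}
    [IsProbabilityMeasure ν] {S : Set X} (hS : MeasurableSet S) {φ : X → ℝ≥0∞} {δ : ℝ≥0∞}
    (hδ : δ ≠ ⊤) (h1 : ∀ x, φ x ≤ 1) (hφ : ∀ x ∉ S, φ x ≤ δ) (h : 2 * δ ≤ ∫⁻ x, φ x ∂ν) :
    δ ≤ ν S := by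
  have : ∫⁻ x, φ x ∂ν ≤ ∫⁻ x, (S.indicator 1 x + δ) ∂ν := by
    refine lintegral_mono fun x => ?_
    by_cases hx : x ∈ S
    · simpa [hx] using (h1 x).trans le_self_add
    · simpa [hx] using hφ x hx
  rw [lintegral_add_right _ measurable_const, lintegral_indicator_one hS, lintegral_const,
    measure_univ, mul_one] at this
  have h2 := h.trans this
  rw [two_mul] at h2
  exact (ENNReal.add_le_add_iff_right hδ).mp h2

end Translates

/-! ### Elements with large centralizer in a topological group. -/

section Centralizers

variable {G : Type*} [Group G] [TopologicalSpace G] [IsTopologicalGroup G] [T2Space G]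

/-- By pigeonhole on `(n + 1)`-tuples, the condition is an intersection of finite unions of closed
commutation relations. -/
theorem isClosed_setOf_relIndexLE_centralizer {Γ : Type*} [TopologicalSpace Γ] {f : Γ → G}
    (hf : Continuous f) (L : Subgroup G) (n : ℕ) :
    IsClosed {x : Γ | RelIndexLE (Subgroup.centralizer {f x}) L n} := by
  simp only [relIndexLE_iff_forall_fin, Subgroup.mem_centralizer_singleton_iff, Set.ofPred_forall,
    Set.ofPred_exists]
  refine isClosed_iInter fun g => isClosed_iUnion_of_finite fun i => isClosed_iUnion_of_finite
    fun j => ?_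
  by_cases hij : i = j
  · simp [hij]
  · simp only [ne_eq, hij, not_false_eq_true, true_and]
    exact isClosed_eq (by fun_prop) (by fun_prop)

/-- The sets of elements with centralizer of index at most `n` are a filtration because `C(x) ∩ C(y)
≤ C(xy)`. The map `f` allows both uses: `K` included in `G` with `L = ⊤`, and the identity of `G`
with `L = K`. -/
theorem exists_subgroup_relIndexLE_centralizer {Γ : Type*} [Group Γ] [TopologicalSpace Γ]
    [IsTopologicalGroup Γ] [MeasurableSpace Γ] [BorelSpace Γ]
    (μ : Measure Γ) [μ.IsMulLeftInvariant] [IsProbabilityMeasure μ] {f : Γ →* G}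
    (hf : Continuous f) (L : Subgroup G) {φ : Γ → ℝ≥0∞} {δ : ℝ≥0∞} (hδ : δ ≠ ⊤) {N : ℕ}
    (hN : 0 < N) (hNδ : 1 < ((N + 1 : ℕ) : ℝ≥0∞) * δ) (h1 : ∀ x, φ x ≤ 1)
    (hφ : ∀ x, 1 < ((N + 1 : ℕ) : ℝ≥0∞) * φ x → RelIndexLE (Subgroup.centralizer {f x}) L N)
    (h : 2 * δ ≤ ∫⁻ x, φ x ∂μ) :
    ∃ H : Subgroup Γ, RelIndexLE H ⊤ N ∧
      ∀ x ∈ H, RelIndexLE (Subgroup.centralizer {f x}) L (N ^ 4 ^ N) := by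
  have hS : MeasurableSet {x | RelIndexLE (Subgroup.centralizer {f x}) L N} :=
    (isClosed_setOf_relIndexLE_centralizer hf L N).measurableSet
  have hle : δ ≤ μ {x | RelIndexLE (Subgroup.centralizer {f x}) L N} := by
    refine le_measure_of_two_mul_le_lintegral hS hδ h1 (fun x hx => ?_) h
    by_contra! hlt
    exact hx (hφ x (hNδ.trans_le (by gcongr)))
  obtain ⟨H, hH, hHN⟩ := exists_subgroup_eq_of_filtration μ
    (S := fun n => {x | RelIndexLE (Subgroup.centralizer {f x}) L n})
    (fun m n hmn x hx => RelIndexLE.mono hx le_rfl hmn)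
    (fun n hn => by
      have : Subgroup.centralizer {f 1} = ⊤ := by ext; simp [Subgroup.mem_centralizer_singleton_iff]
      simp only [Set.mem_ofPred_eq, this, RelIndexLE, Subgroup.relIndex_top_left]
      exact ⟨one_ne_zero, hn⟩)
    (fun n x hx => by
      refine RelIndexLE.mono hx (fun g hg => ?_) le_rfl
      rw [Subgroup.mem_centralizer_singleton_iff] at hg ⊢
      rw [map_inv]
      exact Commute.inv_right (a := g) hg)
    (fun m n x hx y hy => by
      refine (RelIndexLE.inf hx hy).mono (fun g hg => ?_) le_rfl
      obtain ⟨hgx, hgy⟩ := hg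
      replace hgx := Subgroup.mem_centralizer_singleton_iff.mp hgx
      replace hgy := Subgroup.mem_centralizer_singleton_iff.mp hgy
      rw [Subgroup.mem_centralizer_singleton_iff, map_mul]
      exact Commute.mul_right (a := g) hgx hgy)
    hN hS (hNδ.trans_le (by gcongr))
  exact ⟨H, hHN, fun x hx => hH hx⟩

open scoped commutatorElement in
-- A finite subgroup is closed and the commutator map is continuous.
theorem commutator_topologicalClosure_le {T B : Subgroup G} [Finite ↥⁅T, B⁆] :
    ⁅T.topologicalClosure, B.topologicalClosure⁆ ≤ ⁅T, B⁆ := by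
  have hcl : IsClosed ((⁅T, B⁆ : Subgroup G) : Set G) := (Set.toFinite _).isClosed
  refine Subgroup.commutator_le.mpr fun t ht b hb => ?_
  have := map_mem_closure₂ (f := fun x y : G => x * y * x⁻¹ * y⁻¹) (u := (⁅T, B⁆ : Subgroup G))
    (by fun_prop) ht hb fun x hx y hy => Subgroup.commutator_mem_commutator hx hy
  rwa [hcl.closure_eq] at this

end Centralizers

/-! ### Fubini in the other order, and the final assembly. -/

instance normalizedHaar_isMulLeftInvariant (H : Type*) [Group H] [TopologicalSpace H]
    [IsTopologicalGroup H] [CompactSpace H] [MeasurableSpace H] [BorelSpace H] :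
    (normalizedHaar H).IsMulLeftInvariant := by
  unfold normalizedHaar; infer_instance

/-- The swap is a measurable equivalence, so `C` need not be measurable; the commuting set may fail
to be. -/
theorem prod_apply_swap {X Y : Type*} [MeasurableSpace X] [MeasurableSpace Y] (ν : Measure X)
    (μ : Measure Y) [SFinite ν] [SFinite μ] (C : Set (X × Y)) :
    (ν.prod μ) C = (μ.prod ν) (Prod.swap ⁻¹' C) := by
  rw [← Measure.prod_swap]
  exact MeasurableEquiv.prodComm.map_apply C

/-- `Pr(K, G) = ∫_G ν(C_K(y)) dμ(y)`. -/
theorem commutingProbability_eq_lintegral_right {G : Type*} [Group G] [TopologicalSpace G]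
    [IsTopologicalGroup G] [CompactSpace G] [T2Space G] [MeasurableSpace G] [BorelSpace G]
    (K : Subgroup G) (hK : IsClosed (K : Set G)) :
    haveI : CompactSpace K := isCompact_iff_compactSpace.mp hK.isCompact
    commutingProbability K hK =
      ∫⁻ y : G, normalizedHaar K {x : K | (x : G) * y = y * (x : G)} ∂(normalizedHaar G) := by
  have : CompactSpace K := isCompact_iff_compactSpace.mp hK.isCompact
  have hcl : IsClosed {p : G × K | (p.2 : G) * p.1 = p.1 * (p.2 : G)} :=
    isClosed_eq (by fun_prop) (by fun_prop)
  rw [commutingProbability, prod_apply_swap]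
  exact prod_apply_of_isClosed (normalizedHaar G) (normalizedHaar K) hcl

theorem mainTheorem2 (ε : ℝ) (hε : 0 < ε) :
    ∃ n : ℕ, ∀ (G : Type*) [Group G] [TopologicalSpace G] [IsTopologicalGroup G]
      [CompactSpace G] [T2Space G] [MeasurableSpace G] [BorelSpace G]
      (K : Subgroup G) (hK : IsClosed (K : Set G)),
      ENNReal.ofReal ε ≤ commutingProbability K hK →
      ∃ T B : Subgroup G,
        IsClosed (T : Set G) ∧ T.Normal ∧ IsClosed (B : Set G) ∧ B ≤ K ∧
        (T.FiniteIndex ∧ T.index ≤ n) ∧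
        (B.IsFiniteRelIndex K ∧ B.relIndex K ≤ n) ∧
        (Finite ↥⁅T, B⁆ ∧ Nat.card ↥⁅T, B⁆ ≤ n) := by
  set δ : ℝ≥0∞ := ENNReal.ofReal (ε / 2) with hδ
  -- `N` exceeds `1 / δ`, so a subgroup of measure at least `δ` has index at most `N`.
  obtain ⟨N, hN⟩ := exists_nat_gt (2 / ε)
  have hN0 : 0 < N := Nat.cast_pos.mp ((by positivity : (0 : ℝ) < 2 / ε).trans hN)
  have hNδ : 1 < ((N + 1 : ℕ) : ℝ≥0∞) * δ := by
    rw [hδ, ← ENNReal.ofReal_natCast, ← ENNReal.ofReal_mul (by positivity), ENNReal.one_lt_ofReal]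
    rw [div_lt_iff₀ hε] at hN
    push_cast
    linarith
  have h2δ : 2 * δ = ENNReal.ofReal ε := by
    rw [hδ, ← ENNReal.ofReal_ofNat, ← ENNReal.ofReal_mul (by norm_num)]
    congr 1
    ring
  obtain ⟨M, hM⟩ : ∃ M, N ^ 4 ^ N = M := ⟨_, rfl⟩
  obtain ⟨q, hq⟩ : ∃ q, (M * M * (M * M)) ^ (M * M) = q := ⟨_, rfl⟩
  -- The sum of the bounds for `[G : T]` (with a factorial from the normal core), `[K : B]` and the
  -- order of `[T, B]`.
  refine ⟨(q * N).factorial + q * M ^ M * N + (M * M).factorial ^ (M * M), ?_⟩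
  intro G _ _ _ _ _ _ _ K hK hPr
  have : CompactSpace K := isCompact_iff_compactSpace.mp hK.isCompact
  have hclosed (x : G) : IsClosed (Subgroup.centralizer {x} : Set G) := by
    have : (Subgroup.centralizer {x} : Set G) = {y | y * x = x * y} := by
      ext y; exact Subgroup.mem_centralizer_singleton_iff
    rw [this]
    exact isClosed_eq (by fun_prop) (by fun_prop)
  obtain ⟨H, hHN, hH⟩ := exists_subgroup_relIndexLE_centralizer (normalizedHaar K)
    (f := K.subtype) continuous_subtype_val ⊤
    (φ := fun x => normalizedHaar G {y : G | (x : G) * y = y * (x : G)}) ENNReal.ofReal_ne_top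
    hN0 hNδ (fun x => prob_le_one)
    (fun x hx => by
      refine relIndexLE_top_of_one_lt_mul_measure (normalizedHaar G) (hclosed _).measurableSet
        subset_rfl ?_
      convert hx using 3
      ext y
      exact Subgroup.mem_centralizer_singleton_iff.trans eq_comm)
    (by rw [h2δ, ← commutingProbability_eq_lintegral K hK]; exact hPr)
  obtain ⟨E, hEN, hE⟩ := exists_subgroup_relIndexLE_centralizer (normalizedHaar G)
    (f := MonoidHom.id G) continuous_id K
    (φ := fun y => normalizedHaar K {x : K | (x : G) * y = y * (x : G)}) ENNReal.ofReal_ne_top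
    hN0 hNδ (fun x => prob_le_one)
    (fun y hy => by
      have := relIndexLE_top_of_one_lt_mul_measure (normalizedHaar K)
        (H := (Subgroup.centralizer {y}).subgroupOf K) (n := N)
        ((hclosed y).preimage continuous_subtype_val).measurableSet subset_rfl (by
          convert hy using 3
          ext x
          exact Subgroup.mem_centralizer_singleton_iff)
      rwa [RelIndexLE, Subgroup.relIndex_top_right] at this)
    (by rw [h2δ, ← commutingProbability_eq_lintegral_right K hK]; exact hPr)
  rw [hM] at hH hE
  have hBK : H.map K.subtype ≤ K := Subgroup.map_subtype_le H
  have hBN : RelIndexLE (H.map K.subtype) K N := by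
    rw [RelIndexLE, Subgroup.relIndex_top_right] at hHN
    rwa [RelIndexLE, Subgroup.relIndex, Subgroup.subgroupOf,
      Subgroup.comap_map_eq_self_of_injective K.subtype_injective]
  obtain ⟨E₀, hE₀, U₀, hU₀, hE₀i, hU₀i, hfin, hcard⟩ :=
    exists_finite_commutator (B := H.map K.subtype) (E := E) (M := M)
      (by rintro _ ⟨x, hx, rfl⟩; exact (hH x hx).mono_right le_top)
      (fun e he => (hE e he).mono_right hBK)
  rw [hq] at hE₀i hU₀i
  -- Core first, closure second: the closure stays normal and can only lower the index.
  have hT := (hE₀i.trans hEN hE₀ le_top).normalCore.mono (Subgroup.le_topologicalClosure _) le_rfl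
  have hB := (hU₀i.trans hBN hU₀ hBK).mono (Subgroup.le_topologicalClosure _) le_rfl
  rw [RelIndexLE, Subgroup.relIndex_top_right] at hT
  have hle : ⁅E₀.normalCore, U₀⁆ ≤ ⁅E₀, U₀⁆ :=
    Subgroup.commutator_mono E₀.normalCore_le le_rfl
  have : Finite ↥⁅E₀.normalCore, U₀⁆ := Finite.Set.subset (⁅E₀, U₀⁆ : Subgroup G) hle
  have hle' := commutator_topologicalClosure_le.trans hle
  refine ⟨E₀.normalCore.topologicalClosure, U₀.topologicalClosure,
    Subgroup.isClosed_topologicalClosure _, Subgroup.is_normal_topologicalClosure _,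
    Subgroup.isClosed_topologicalClosure _,
    Subgroup.topologicalClosure_minimal _ (hU₀.trans hBK) hK,
    ⟨⟨hT.1⟩, hT.2.trans (by omega)⟩, ⟨⟨hB.1⟩, hB.2.trans (by omega)⟩,
    Finite.Set.subset (⁅E₀, U₀⁆ : Subgroup G) hle', ?_⟩
  exact (Subgroup.card_le_of_le hle').trans (hcard.trans (by omega))
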